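/- **Theorem 3.1.** Let $1\le r,s\le m$, let $U_r\in\mathbb R^{m\times r}$ and $S\in\mathbb R^{m\times s}$ have orthonormal columns, and let $$D=U_r\,(S^TU_r)^{\dagger}\,S^T ,$$ where $\dagger$ is the Moore-Penrose inverse. Write $P_S=SS^T$ and $P_{U_r}=U_rU_r^T$ for the orthogonal projectors onto the column spaces $\mathcal R(S)$ and $\mathcal R(U_r)$. Put $\ell=\dim(\mathcal R(S)\cap\mathcal R(U_r))$ and $p=\operatorname{rank}(D)-\ell$. Let $\sigma_1\ge\sigma_2\ge\dots\ge\sigma_{\min(r,s)}$ be the singular values of $S^TU_r$, and let $\psi_i=\arccos\sigma_i$. Then $p\ge 0$, $\ell+p\le\min(r,s)$, and $$1=\sigma_1=\dots=\sigma_\ell>\sigma_{\ell+1}\ge\dots\ge\sigma_{\ell+p}>\sigma_{\ell+p+1}=\dots=\sigma_{\min(r,s)}=0 .$$ Moreover $\psi_1\le\dots\le\psi_{\min(r,s)}$ are the principal angles between $\mathcal R(S)$ and $\mathcal R(U_r)$, with $\sigma_i=\cos\psi_i$ and $0<\psi_{\ell+1}\le\dots\le\psi_{\ell+p}<\pi/2$.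 (The principal angles between subspaces $V,W$ are defined recursively: $\psi_k\in[0,\pi/2]$ and $\cos\psi_k=v_k^Tw_k$ is the maximum of $x^Ty$ over unit vectors $x\in V$, $y\in W$ with $x\perp v_j$ and $y\perp w_j$ for all $j<k$, where $v_k\in V$, $w_k\in W$ are admissible unit vectors attaining it.) Furthermore: (i) $\ell+2p\le m$, and there is an orthogonal matrix $Z\in\mathbb R^{m\times m}$ such that $$D=(P_SP_{U_r})^{\dagger}=Z\begin{pmatrix} I_\ell & & \\ & \bigoplus_{i=1}^{p}T_i & \\ & & 0\end{pmatrix}Z^T,\qquad T_i=\begin{pmatrix}1&0\\ \tan\psi_{\ell+i}&0\end{pmatrix},$$ where the zero block is square of order $m-\ell-2p$. (ii) If $D\ne 0$, then $\ell+p\ge 1$ and $\|D\|_2=1/\cos\psi_{\ell+p}$, where $\|\cdot\|_2$ is the spectral norm. If $D\ne 0$ and $D\ne I_m$, then $\|D\|_2=\|I_m-D\|_2=1/\cos\psi_{\ell+p}$. -/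

import Mathlib

open scoped Matrix Matrix.Norms.L2Operator

/-- The four Penrose conditions: `X` is a Moore-Penrose inverse of the real matrix `A`. -/
structure IsMoorePenrose {a b : Type*} [Fintype a] [Fintype b]
    (A : Matrix a b ℝ) (X : Matrix b a ℝ) : Prop where
  mul_mul_self : A * X * A = A
  self_mul_mul : X * A * X = X
  left_symm : (A * X)ᵀ = A * X
  right_symm : (X * A)ᵀ = X * A

theorem IsMoorePenrose.unique {a b : Type*} [Fintype a] [Fintype b]
    {A : Matrix a b ℝ} {X Y : Matrix b a ℝ}
    (hX : IsMoorePenrose A X) (hY : IsMoorePenrose A Y) : X = Y := by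
  have h1 : A * X = A * Y := by
    calc A * X = (A * X)ᵀ := hX.left_symm.symm
      _ = ((A * Y * A) * X)ᵀ := by rw [hY.mul_mul_self]
      _ = (A * X)ᵀ * (A * Y)ᵀ := by rw [← Matrix.transpose_mul]; simp only [Matrix.mul_assoc]
      _ = A * X * (A * Y) := by rw [hX.left_symm, hY.left_symm]
      _ = A * X * A * Y := by simp only [Matrix.mul_assoc]
      _ = A * Y := by rw [hX.mul_mul_self]
  have h2 : X * A = Y * A := by
    calc X * A = (X * A)ᵀ := hX.right_symm.symm
      _ = (X * (A * Y * A))ᵀ := by rw [hY.mul_mul_self]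
      _ = (Y * A)ᵀ * (X * A)ᵀ := by rw [← Matrix.transpose_mul]; simp only [Matrix.mul_assoc]
      _ = Y * A * (X * A) := by rw [hX.right_symm, hY.right_symm]
      _ = Y * (A * X * A) := by simp only [Matrix.mul_assoc]
      _ = Y * A := by rw [hX.mul_mul_self]
  calc X = X * A * X := hX.self_mul_mul.symm
    _ = Y * (A * X) := by rw [h2, Matrix.mul_assoc]
    _ = Y * A * Y := by rw [h1, Matrix.mul_assoc]
    _ = Y := hY.self_mul_mul

theorem exists_isMoorePenrose {a b : Type*} [Fintype a] [Fintype b]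
    (A : Matrix a b ℝ) : ∃ X, IsMoorePenrose A X := by
  classical
  have hH : (Aᵀ * A).IsHermitian := by
    have := Matrix.isHermitian_conjTranspose_mul_self A
    rwa [Matrix.conjTranspose_eq_transpose_of_trivial] at this
  obtain ⟨G, h1, h2, h3, h4⟩ : ∃ G : Matrix b b ℝ, Aᵀ * A * G * (Aᵀ * A) = Aᵀ * A ∧
      G * (Aᵀ * A) * G = G ∧ Gᵀ = G ∧ (G * (Aᵀ * A))ᵀ = G * (Aᵀ * A) := by
    set V : Matrix b b ℝ := (hH.eigenvectorUnitary : Matrix b b ℝ) with hV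
    set d := hH.eigenvalues with hd
    have hVV : Vᵀ * V = 1 := by
      have := Matrix.UnitaryGroup.star_mul_self hH.eigenvectorUnitary
      rwa [Matrix.star_eq_conjTranspose, Matrix.conjTranspose_eq_transpose_of_trivial] at this
    have hs : Aᵀ * A = V * Matrix.diagonal d * Vᵀ := by
      have := hH.spectral_theorem
      rw [Unitary.conjStarAlgAut_apply] at this
      rw [Matrix.star_eq_conjTranspose, Matrix.conjTranspose_eq_transpose_of_trivial] at this
      exact this
    have key : ∀ x y : b → ℝ, V * Matrix.diagonal x * Vᵀ * (V * Matrix.diagonal y * Vᵀ)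
        = V * Matrix.diagonal (x * y) * Vᵀ := by
      intro x y
      calc _ = V * Matrix.diagonal x * (Vᵀ * V) * Matrix.diagonal y * Vᵀ := by
            simp only [Matrix.mul_assoc]
        _ = _ := by
            rw [hVV, Matrix.mul_one, Matrix.mul_assoc V, Matrix.diagonal_mul_diagonal]; rfl
    have tr : ∀ x : b → ℝ, (V * Matrix.diagonal x * Vᵀ)ᵀ = V * Matrix.diagonal x * Vᵀ := by
      intro x
      simp [Matrix.transpose_mul, Matrix.mul_assoc]
    refine ⟨V * Matrix.diagonal d⁻¹ * Vᵀ, ?_, ?_, tr _, ?_⟩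
    · rw [hs, key, key]
      congr 3
      ext i
      by_cases h : d i = 0 <;> simp [h]
    · rw [hs, key, key]
      congr 3
      ext i
      by_cases h : d i = 0 <;> simp [h]
    · rw [hs, key, tr]
  refine ⟨G * Aᵀ, ?_, ?_, ?_, ?_⟩
  · have h5 : (A * (G * (Aᵀ * A)) - A)ᵀ * (A * (G * (Aᵀ * A)) - A) = 0 := by
      have e : (A * (G * (Aᵀ * A)) - A)ᵀ = G * (Aᵀ * A) * Aᵀ - Aᵀ := by
        rw [Matrix.transpose_sub, Matrix.transpose_mul, h4]
      have h6 : G * (Aᵀ * A) = Aᵀ * A * G := by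
        rw [← h4, Matrix.transpose_mul, Matrix.transpose_mul, Matrix.transpose_transpose, h3]
      have e2 : (G * (Aᵀ * A) * Aᵀ - Aᵀ) * (A * (G * (Aᵀ * A)) - A)
          = G * (Aᵀ * A) * (Aᵀ * A * G * (Aᵀ * A)) - Aᵀ * A * G * (Aᵀ * A)
            - (Aᵀ * A * G * (Aᵀ * A) - Aᵀ * A) - (G * (Aᵀ * A) * (Aᵀ * A) - Aᵀ * A * G * (Aᵀ * A))
            := by
        rw [Matrix.sub_mul, Matrix.mul_sub, Matrix.mul_sub]
        simp only [Matrix.mul_assoc]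
        abel
      rw [e, e2, h1]
      rw [show G * (Aᵀ * A) * (Aᵀ * A) = Aᵀ * A by rw [h6, h1]]
      simp
    rw [← Matrix.conjTranspose_eq_transpose_of_trivial,
      Matrix.conjTranspose_mul_self_eq_zero, sub_eq_zero] at h5
    simpa only [Matrix.mul_assoc] using h5
  · calc _ = G * (Aᵀ * A) * G * Aᵀ := by simp only [Matrix.mul_assoc]
      _ = _ := by rw [h2]
  · simp [Matrix.transpose_mul, h3, Matrix.mul_assoc]
  · simpa only [Matrix.mul_assoc] using h4

/-- The Moore-Penrose inverse of a real matrix: the unique matrix satisfying the Penrose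
conditions. -/
noncomputable def pinv {a b : Type*} [Fintype a] [Fintype b]
    (A : Matrix a b ℝ) : Matrix b a ℝ :=
  (exists_isMoorePenrose A).choose

theorem pinv_spec {a b : Type*} [Fintype a] [Fintype b]
    (A : Matrix a b ℝ) : IsMoorePenrose A (pinv A) :=
  (exists_isMoorePenrose A).choose_spec

/-- The range (column space) of a matrix, as a subspace of Euclidean space. -/
noncomputable def colSpace {m k : ℕ} (A : Matrix (Fin m) (Fin k) ℝ) :
    Submodule ℝ (EuclideanSpace ℝ (Fin m)) :=
  LinearMap.range (Matrix.toEuclideanLin A)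

/-- The singular values of a matrix in nonincreasing order, indexed from `0`
(those beyond the matrix dimensions are `0`). -/
noncomputable def matrixSingularValue {s r : ℕ} (A : Matrix (Fin s) (Fin r) ℝ) (i : ℕ) : ℝ :=
  (Matrix.toEuclideanLin A).singularValues i

/-- `θ` is the sequence of the first `q` principal (canonical) angles between the subspaces
`V` and `W`, in the usual recursive sense: there are principal vectors `v k ∈ V`, `w k ∈ W` such
that `cos (θ k)` is the maximum of `⟪x, y⟫` over unit vectors `x ∈ V`, `y ∈ W` with `x` orthogonal
to the earlier `v j` and `y` orthogonal to the earlier `w j`, attained at `(v k, w k)`. -/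
def IsPrincipalAngles {E : Type*} [NormedAddCommGroup E] [InnerProductSpace ℝ E]
    (V W : Submodule ℝ E) (q : ℕ) (θ : ℕ → ℝ) : Prop :=
  ∃ v w : ℕ → E, ∀ k < q,
    (0 ≤ θ k ∧ θ k ≤ Real.pi / 2) ∧
    (v k ∈ V ∧ ‖v k‖ = 1 ∧ ∀ j < k, inner ℝ (v j) (v k) = 0) ∧
    (w k ∈ W ∧ ‖w k‖ = 1 ∧ ∀ j < k, inner ℝ (w j) (w k) = 0) ∧
    inner ℝ (v k) (w k) = Real.cos (θ k) ∧
    ∀ x ∈ V, ∀ y ∈ W, ‖x‖ = 1 → ‖y‖ = 1 →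
      (∀ j < k, inner ℝ (v j) x = 0) → (∀ j < k, inner ℝ (w j) y = 0) →
      inner ℝ x y ≤ Real.cos (θ k)

/-- The `2 × 2` block `T(ψ)`. -/
noncomputable def blockT (ψ : ℝ) : Matrix (Fin 2) (Fin 2) ℝ :=
  !![1, 0; Real.tan ψ, 0]

/-- The block diagonal matrix `diag(I_ℓ, T(ψ 0) ⊕ ⋯ ⊕ T(ψ (p-1)), 0_k)` of order `ℓ + 2p + k`.
`finProdFinEquiv` places entry `a : Fin 2` of block `i : Fin p` at position `2 * i + a`. -/
noncomputable def canonicalForm (ℓ p k : ℕ) (ψ : Fin p → ℝ) :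
    Matrix (Fin (ℓ + p * 2 + k)) (Fin (ℓ + p * 2 + k)) ℝ :=
  Matrix.reindex finSumFinEquiv finSumFinEquiv
    (Matrix.fromBlocks
      (Matrix.reindex finSumFinEquiv finSumFinEquiv
        (Matrix.fromBlocks
          (1 : Matrix (Fin ℓ) (Fin ℓ) ℝ) 0
          0 (Matrix.reindex ((Equiv.prodComm _ _).trans finProdFinEquiv)
              ((Equiv.prodComm _ _).trans finProdFinEquiv)
              (Matrix.blockDiagonal fun i => blockT (ψ i)))))
      0
      0 (0 : Matrix (Fin k) (Fin k) ℝ))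

/-!
# Canonical form of the oblique projection `U (Sᵀ U)⁺ Sᵀ`

Everything is read off from principal vectors of the pair of column spaces. A singular value
decomposition of `Sᵀ U`, with singular vectors `u i`, `v i`, gives orthonormal bases `x i = S (v i)`
of `colSpace S` and `y i = U (u i)` of `colSpace U` with `⟪x i, y j⟫ = σ i` for `i = j` and `0`
otherwise (`IsPrincipalVectors`, `exists_isPrincipalVectors_colSpace`).

* A vector `z` in both subspaces satisfies `⟪y i, z⟫ = σ i ^ 2 * ⟪y i, z⟫`, so the intersection is
  spanned by the `x i = y i` with `σ i = 1`; its dimension counts the singular values equal to `1`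
  (`IsPrincipalVectors.eq_one_iff_lt_finrank_inf`). The rank of `D` is that of `Sᵀ U` and counts the
  nonzero ones.
* `⟪z, t⟫ = ∑ σ i ⟪x i, z⟫ ⟪y i, t⟫` for `z`, `t` in the two subspaces, and Bessel's inequality
  gives the variational description of the angles (`IsPrincipalVectors.isPrincipalAngles`).
* `D z = ∑ (σ i)⁻¹ ⟪x i, z⟫ y i` (`IsPrincipalVectors.apply_eq_sum`). Hence `D` is idempotent and
  its norm is the largest `(σ i)⁻¹`. The norm of `1 - D` agrees with it, as for every
  nontrivial idempotent of an inner product space (`norm_one_sub_eq_of_isIdempotentElem`).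
* For `0 < σ i < 1` let `e i` be the normalized component of `y i` orthogonal to `x i`. Then
  `D (x i) = x i + tan (ψ i) e i` and `D (e i) = 0`, which is the block `T (ψ i)`; on the common
  vectors `D` is the identity, and on the complement of all these it is `0`
  (`IsPrincipalVectors.exists_orthonormalBasis_apply_eq`).

Sequences of vectors are indexed by `ℕ` and padded with zeros (`OrthonormalBelow`), and `0⁻¹ = 0` is
used on purpose: the terms with `σ i = 0` drop out of the formula for `D` just as they do in the
Moore-Penrose inverse.
-/

/-! ### Orthonormal families padded with zeros -/

/-- `x 0, …, x (n - 1)` is an orthonormal family and all later terms of the sequence `x` vanish. -/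
def OrthonormalBelow {E : Type*} [NormedAddCommGroup E] [InnerProductSpace ℝ E]
    (n : ℕ) (x : ℕ → E) : Prop :=
  ∀ i j, inner ℝ (x i) (x j) = if i = j ∧ i < n then (1 : ℝ) else 0

namespace OrthonormalBelow

variable {E : Type*} [NormedAddCommGroup E] [InnerProductSpace ℝ E] {n : ℕ} {x : ℕ → E}

theorem norm_eq_one (h : OrthonormalBelow n x) {i : ℕ} (hi : i < n) : ‖x i‖ = 1 := by
  rw [← sq_eq_sq₀ (norm_nonneg _) zero_le_one, ← real_inner_self_eq_norm_sq, h]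
  simp [hi]

theorem eq_zero (h : OrthonormalBelow n x) {i : ℕ} (hi : n ≤ i) : x i = 0 := by
  rw [← inner_self_eq_zero (𝕜 := ℝ), h]
  simp [hi]

theorem orthonormal (h : OrthonormalBelow n x) {k : ℕ} (hk : k ≤ n) :
    Orthonormal ℝ fun i : Fin k => x i := by
  rw [orthonormal_iff_ite]
  intro i j
  have := i.2
  rw [h]
  simp only [Fin.ext_iff]
  congr 1
  simp only [eq_iff_iff, and_iff_left_iff_imp]
  omega

/-- Only an inequality, since the coefficients of vanishing `x j` are counted on the right. -/
theorem norm_sq_sum_le (h : OrthonormalBelow n x) (a : ℕ → ℝ) (k : ℕ) :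
    ‖∑ j ∈ Finset.range k, a j • x j‖ ^ 2 ≤ ∑ j ∈ Finset.range k, a j ^ 2 := by
  rw [← real_inner_self_eq_norm_sq, sum_inner]
  refine Finset.sum_le_sum fun i hi => ?_
  simp only [inner_sum, inner_smul_right, inner_smul_left, h i, conj_trivial]
  by_cases hin : i < n
  · simp [hin, Finset.mem_range.1 hi, sq]
  · simp [hin, sq_nonneg]

/-- Bessel's inequality. -/
theorem sum_sq_inner_le (h : OrthonormalBelow n x) (z : E) (k : ℕ) :
    ∑ j ∈ Finset.range k, inner ℝ (x j) z ^ 2 ≤ ‖z‖ ^ 2 := by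
  have h1 := h.norm_sq_sum_le (fun j => inner ℝ (x j) z) k
  have h2 := norm_sub_sq_real z (∑ j ∈ Finset.range k, inner ℝ (x j) z • x j)
  have h3 : inner ℝ z (∑ j ∈ Finset.range k, inner ℝ (x j) z • x j) =
      ∑ j ∈ Finset.range k, inner ℝ (x j) z ^ 2 := by
    rw [inner_sum]
    refine Finset.sum_congr rfl fun j _ => ?_
    rw [inner_smul_right, real_inner_comm, sq]
  nlinarith [sq_nonneg ‖z - ∑ j ∈ Finset.range k, inner ℝ (x j) z • x j‖]

theorem sum_inner_smul_eq (h : OrthonormalBelow n x) {z : E}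
    (hz : z ∈ Submodule.span ℝ (Set.range x)) :
    ∑ j ∈ Finset.range n, inner ℝ (x j) z • x j = z := by
  induction hz using Submodule.span_induction with
  | mem z hz =>
    obtain ⟨i, rfl⟩ := hz
    by_cases hi : i < n
    · rw [Finset.sum_eq_single_of_mem i (Finset.mem_range.2 hi)]
      · rw [h]; simp [hi]
      · intro j _ hj
        rw [h]; simp [hj]
    · simp [h.eq_zero (not_lt.1 hi)]
  | zero => simp
  | add a b _ _ ha hb => simp only [inner_add_right, add_smul, Finset.sum_add_distrib, ha, hb]
  | smul c a _ ha =>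
    simp only [inner_smul_right, mul_smul, ← Finset.smul_sum, ha]

end OrthonormalBelow

/-! ### Singular value decomposition -/

/-- Singular value decomposition of a linear map between Euclidean spaces. The singular vectors
`u i`, `v i` are indexed by `ℕ` and extended by `0` beyond the dimension, in the same way as
`LinearMap.singularValues`, so that no case distinction on the index is needed. -/
theorem LinearMap.exists_singularVectors {E F : Type*}
    [NormedAddCommGroup E] [InnerProductSpace ℝ E] [FiniteDimensional ℝ E]
    [NormedAddCommGroup F] [InnerProductSpace ℝ F] [FiniteDimensional ℝ F]
    (T : E →ₗ[ℝ] F) {r s : ℕ} (hr : Module.finrank ℝ E = r) (hs : Module.finrank ℝ F = s) :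
    ∃ (u : ℕ → E) (v : ℕ → F),
      OrthonormalBelow r u ∧ OrthonormalBelow s v ∧
      Submodule.span ℝ (Set.range u) = ⊤ ∧ Submodule.span ℝ (Set.range v) = ⊤ ∧
      (∀ i, T (u i) = T.singularValues i • v i) ∧
      (∀ i, T.adjoint (v i) = T.singularValues i • u i) := by
  set u := T.isSymmetric_adjoint_comp_self.eigenvectorBasis hr with hu
  set ρ := Module.finrank ℝ (LinearMap.range T) with hρ
  have hρs : ρ ≤ s := hs ▸ Submodule.finrank_le _
  have hρr : ρ ≤ r := hr ▸ LinearMap.finrank_range_le T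
  have hTT : ∀ i, T.adjoint (T (u i)) = (T.singularValues i ^ 2) • u i := by
    intro i
    have := T.isSymmetric_adjoint_comp_self.apply_eigenvectorBasis hr i
    rw [T.sq_singularValues_fin hr]
    exact this
  have hin : ∀ i j, inner ℝ (T (u i)) (T (u j)) = if i = j then T.singularValues i ^ 2 else 0 := by
    intro i j
    rw [← LinearMap.adjoint_inner_left, hTT, inner_smul_left, u.inner_eq_ite]
    split_ifs <;> simp
  have hpos : ∀ i : ℕ, i < ρ → T.singularValues i ≠ 0 := fun i hi =>
    (T.singularValues_pos_iff_lt_finrank_range.2 hi).ne'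
  have hzero : ∀ i : ℕ, ρ ≤ i → T.singularValues i = 0 := fun i hi =>
    T.singularValues_eq_zero_iff_le_finrank_range.2 hi
  -- The vectors `T (u j) / σ j` with `σ j ≠ 0` are orthonormal and extend to the basis `v`.
  let w : Fin s → F := fun j =>
    if h : (j : ℕ) < r then (T.singularValues j)⁻¹ • T (u ⟨j, h⟩) else 0
  have hw : Orthonormal ℝ (Set.domRestrict {j : Fin s | (j : ℕ) < ρ} w) := by
    rw [orthonormal_iff_ite]
    rintro ⟨i, hi⟩ ⟨j, hj⟩
    have hi' : (i : ℕ) < ρ := hi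
    have hj' : (j : ℕ) < ρ := hj
    simp only [Set.domRestrict_apply, w, dif_pos (hi'.trans_le hρr), dif_pos (hj'.trans_le hρr),
      inner_smul_left, inner_smul_right, hin, Subtype.mk.injEq, Fin.ext_iff]
    have := hpos i hi'
    split_ifs with h
    · rw [← h]
      simp
      field_simp
    · simp
  obtain ⟨v, hv⟩ := hw.exists_orthonormalBasis_extension_of_card_eq (by simp [hs])
  have hTu : ∀ i (hi : i < r), T (u ⟨i, hi⟩) =
      T.singularValues i • if h : i < s then v ⟨i, h⟩ else 0 := by
    intro i hi
    by_cases h : i < ρ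
    · rw [dif_pos (h.trans_le hρs), hv ⟨i, h.trans_le hρs⟩ h]
      simp only [w, dif_pos hi]
      rw [smul_inv_smul₀ (hpos i h)]
    · rw [hzero i (not_lt.1 h), zero_smul, ← norm_eq_zero, ← sq_eq_zero_iff,
        ← real_inner_self_eq_norm_sq, hin, if_pos rfl, hzero i (not_lt.1 h)]
      simp
  refine ⟨fun i => if h : i < r then u ⟨i, h⟩ else 0, fun i => if h : i < s then v ⟨i, h⟩ else 0,
    ?_, ?_, ?_, ?_, ?_, ?_⟩
  · intro i j
    by_cases hi : i < r <;> by_cases hj : j < r <;>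
      simp [hi, hj, u.inner_eq_ite]
    omega
  · intro i j
    by_cases hi : i < s <;> by_cases hj : j < s <;>
      simp [hi, hj, v.inner_eq_ite]
    omega
  · rw [eq_top_iff, ← u.toBasis.span_eq, Submodule.span_le]
    rintro _ ⟨i, rfl⟩
    exact Submodule.subset_span ⟨i, by simp⟩
  · rw [eq_top_iff, ← v.toBasis.span_eq, Submodule.span_le]
    rintro _ ⟨i, rfl⟩
    exact Submodule.subset_span ⟨i, by simp⟩
  · intro i
    by_cases hi : i < r
    · simp only [dif_pos hi, hTu i hi]
    · simp [hi, hzero i (hρr.trans (not_lt.1 hi))]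
  · intro i
    by_cases hi : i < s
    · refine InnerProductSpace.ext_inner_left_basis u.toBasis fun j => ?_
      rw [u.coe_toBasis, LinearMap.adjoint_inner_right, hTu j j.2, inner_smul_left,
        inner_smul_right]
      by_cases hj : (j : ℕ) < s
      · by_cases hir : i < r
        · simp only [dif_pos hj, dif_pos hi, dif_pos hir, v.inner_eq_ite, u.inner_eq_ite,
            Fin.ext_iff]
          split_ifs with h <;> simp [h]
        · have : (j : ℕ) ≠ i := by omega
          simp [hi, hj, hir, v.inner_eq_ite, this]
      · by_cases hir : i < r
        · have : (j : ℕ) ≠ i := by omega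
          simp [hj, hir, u.inner_eq_ite, Fin.ext_iff, this]
        · simp [hj, hir]
    · simp [hi, hzero i (hρs.trans (not_lt.1 hi))]

/-! ### Norms of complementary projections -/

/-- In an inner product space a bound for a nonzero idempotent operator is also a bound for its
complementary idempotent. -/
theorem norm_one_sub_le_of_isIdempotentElem {E : Type*} [NormedAddCommGroup E]
    [InnerProductSpace ℝ E] {P : E →L[ℝ] E} (hP : IsIdempotentElem P) (h0 : P ≠ 0) :
    ‖1 - P‖ ≤ ‖P‖ := by
  have hPP : ∀ z, P (P z) = P z := fun z => congrArg (fun A : E →L[ℝ] E => A z) hP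
  have h1 : 1 ≤ ‖P‖ := by
    have hpos : 0 < ‖P‖ := norm_pos_iff.2 h0
    have := norm_mul_le P P
    rw [hP.eq] at this
    exact le_of_mul_le_mul_right (by simpa using this) hpos
  refine ContinuousLinearMap.opNorm_le_bound _ (norm_nonneg _) fun z => ?_
  set a := P z with ha
  set b := z - a with hb
  have hz : z = a + b := by simp [hb]
  have hPb : P b = 0 := by simp [hb, ha, hPP]
  have hQ : (1 - P) z = b := by simp [hb, ha]
  rw [hQ]
  by_cases ha0 : a = 0
  · have hbz : b = z := by simp [hb, ha0]
    rw [hbz]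
    exact le_mul_of_one_le_left (norm_nonneg _) h1
  by_cases hb0 : b = 0
  · rw [hb0, norm_zero]
    positivity
  have na : ‖a‖ ≠ 0 := norm_ne_zero_iff.2 ha0
  have nb : ‖b‖ ≠ 0 := norm_ne_zero_iff.2 hb0
  -- Exchanging the lengths of the two components of `z` does not change its norm.
  set y := (‖b‖ / ‖a‖) • a + (‖a‖ / ‖b‖) • b with hy
  have hny : ‖y‖ = ‖z‖ := by
    rw [← sq_eq_sq₀ (norm_nonneg _) (norm_nonneg _), hz, norm_add_sq_real, norm_add_sq_real,
      norm_smul, norm_smul, inner_smul_left, inner_smul_right]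
    simp only [norm_div, norm_norm, conj_trivial]
    field_simp
    ring
  have hPy : P y = (‖b‖ / ‖a‖) • a := by
    rw [hy, map_add, map_smul, map_smul, hPb, ha, hPP]
    simp
  calc ‖b‖ = ‖P y‖ := by
        rw [hPy, norm_smul, norm_div, norm_norm, norm_norm, div_mul_cancel₀ _ na]
    _ ≤ ‖P‖ * ‖y‖ := P.le_opNorm y
    _ = ‖P‖ * ‖z‖ := by rw [hny]

theorem norm_one_sub_eq_of_isIdempotentElem {E : Type*} [NormedAddCommGroup E]
    [InnerProductSpace ℝ E] {P : E →L[ℝ] E} (hP : IsIdempotentElem P) (h0 : P ≠ 0) (h1 : P ≠ 1) :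
    ‖1 - P‖ = ‖P‖ := by
  refine (norm_one_sub_le_of_isIdempotentElem hP h0).antisymm ?_
  simpa using norm_one_sub_le_of_isIdempotentElem hP.one_sub (sub_ne_zero.2 h1.symm)

/-! ### Principal vectors of a pair of subspaces -/

/-- Principal vectors of a pair of subspaces: orthonormal bases `x 0, …, x (s - 1)` of `V` and
`y 0, …, y (r - 1)` of `W`, padded with zeros, which are biorthogonal to each other with
nonincreasing nonnegative cosines `σ i = ⟪x i, y i⟫`. -/
structure IsPrincipalVectors {E : Type*} [NormedAddCommGroup E] [InnerProductSpace ℝ E]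
    (V W : Submodule ℝ E) (s r : ℕ) (σ : ℕ → ℝ) (x y : ℕ → E) : Prop where
  left : OrthonormalBelow s x
  right : OrthonormalBelow r y
  span_left : Submodule.span ℝ (Set.range x) = V
  span_right : Submodule.span ℝ (Set.range y) = W
  inner_eq : ∀ i j, inner ℝ (x i) (y j) = if i = j then σ i else 0
  antitone : Antitone σ
  nonneg : ∀ i, 0 ≤ σ i

namespace IsPrincipalVectors

variable {E : Type*} [NormedAddCommGroup E] [InnerProductSpace ℝ E]
  {V W : Submodule ℝ E} {s r : ℕ} {σ : ℕ → ℝ} {x y : ℕ → E}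

theorem symm (h : IsPrincipalVectors V W s r σ x y) : IsPrincipalVectors W V r s σ y x where
  left := h.right
  right := h.left
  span_left := h.span_right
  span_right := h.span_left
  inner_eq i j := by
    rw [real_inner_comm, h.inner_eq]
    by_cases hij : i = j
    · simp [hij]
    · simp [hij, Ne.symm hij]
  antitone := h.antitone
  nonneg := h.nonneg

theorem left_mem (h : IsPrincipalVectors V W s r σ x y) (i : ℕ) : x i ∈ V :=
  h.span_left ▸ Submodule.subset_span ⟨i, rfl⟩

theorem right_mem (h : IsPrincipalVectors V W s r σ x y) (i : ℕ) : y i ∈ W :=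
  h.symm.left_mem i

theorem sum_inner_smul_eq_left (h : IsPrincipalVectors V W s r σ x y) {z : E} (hz : z ∈ V) :
    ∑ j ∈ Finset.range s, inner ℝ (x j) z • x j = z :=
  h.left.sum_inner_smul_eq (h.span_left ▸ hz)

theorem eq_zero_of_le_left (h : IsPrincipalVectors V W s r σ x y) {i : ℕ} (hi : s ≤ i) :
    σ i = 0 := by
  have := h.inner_eq i i
  rw [h.left.eq_zero hi] at this
  simpa using this.symm

theorem lt_left (h : IsPrincipalVectors V W s r σ x y) {i : ℕ} (hi : 0 < σ i) : i < s := by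
  by_contra hs
  exact hi.ne' (h.eq_zero_of_le_left (not_lt.1 hs))

theorem lt_right (h : IsPrincipalVectors V W s r σ x y) {i : ℕ} (hi : 0 < σ i) : i < r :=
  h.symm.lt_left hi

theorem le_one (h : IsPrincipalVectors V W s r σ x y) (i : ℕ) : σ i ≤ 1 := by
  rcases (h.nonneg i).eq_or_lt with h0 | h0
  · rw [← h0]; exact zero_le_one
  · have := real_inner_le_norm (x i) (y i)
    rw [h.inner_eq, if_pos rfl, h.left.norm_eq_one (h.lt_left h0),
      h.right.norm_eq_one (h.lt_right h0), one_mul] at this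
    exact this

theorem inner_right_of_mem (h : IsPrincipalVectors V W s r σ x y) {z : E} (hz : z ∈ V) (i : ℕ) :
    inner ℝ (y i) z = σ i * inner ℝ (x i) z := by
  rw [← h.span_left] at hz
  induction hz using Submodule.span_induction with
  | mem z hz =>
    obtain ⟨j, rfl⟩ := hz
    rw [h.symm.inner_eq, h.left]
    by_cases hi : i < s
    · simp [hi]
    · simp [h.eq_zero_of_le_left (not_lt.1 hi)]
  | zero => simp
  | add a b _ _ ha hb => rw [inner_add_right, inner_add_right, ha, hb, mul_add]
  | smul c a _ ha => rw [inner_smul_right, inner_smul_right, ha]; ring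

theorem inner_left_of_mem (h : IsPrincipalVectors V W s r σ x y) {z : E} (hz : z ∈ W) (i : ℕ) :
    inner ℝ (x i) z = σ i * inner ℝ (y i) z :=
  h.symm.inner_right_of_mem hz i

theorem eq_of_eq_one (h : IsPrincipalVectors V W s r σ x y) {i : ℕ} (hi : σ i = 1) :
    x i = y i := by
  have h0 : 0 < σ i := hi ▸ zero_lt_one
  rw [← inner_eq_one_iff_of_norm_eq_one (𝕜 := ℝ) (h.left.norm_eq_one (h.lt_left h0))
    (h.right.norm_eq_one (h.lt_right h0)), h.inner_eq, if_pos rfl, hi]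

/-- The intersection of the two subspaces is spanned by the principal vectors with cosine `1`:
for `z` in both subspaces, `⟪y i, z⟫ = σ i ^ 2 * ⟪y i, z⟫`. -/
theorem inf_eq_span (h : IsPrincipalVectors V W s r σ x y) {N : ℕ}
    (hN : ∀ i, σ i = 1 ↔ i < N) :
    V ⊓ W = Submodule.span ℝ (Set.range fun i : Fin N => y i) := by
  apply le_antisymm
  · rintro z ⟨hV, hW⟩
    rw [← h.symm.sum_inner_smul_eq_left hW]
    refine Submodule.sum_mem _ fun i _ => ?_
    by_cases hi : σ i = 1
    · exact Submodule.smul_mem _ _ (Submodule.subset_span ⟨⟨i, (hN i).1 hi⟩, rfl⟩)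
    · have h1 := h.inner_right_of_mem hV i
      rw [h.inner_left_of_mem hW i] at h1
      have h2 : (1 - σ i) * (1 + σ i) * inner ℝ (y i) z = 0 := by linear_combination h1
      have h3 : 1 - σ i ≠ 0 := sub_ne_zero.2 (Ne.symm hi)
      have h4 : 1 + σ i ≠ 0 := by linarith [h.nonneg i]
      have h5 : inner ℝ (y i) z = 0 := by simpa [h3, h4] using h2
      rw [h5, zero_smul]
      exact Submodule.zero_mem _
  · rw [Submodule.span_le]
    rintro _ ⟨i, rfl⟩
    refine ⟨?_, h.right_mem i⟩
    have := h.left_mem i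
    rwa [h.eq_of_eq_one ((hN i).2 i.2)] at this

theorem exists_eq_one_iff_lt (h : IsPrincipalVectors V W s r σ x y) :
    ∃ N, ∀ i, σ i = 1 ↔ i < N := by
  have hex : ∃ i, σ i ≠ 1 := ⟨s, by rw [h.eq_zero_of_le_left le_rfl]; exact zero_ne_one⟩
  classical
  refine ⟨Nat.find hex, fun i => ⟨fun hi => ?_, fun hi => not_not.1 (Nat.find_min hex hi)⟩⟩
  by_contra hlt
  have := h.antitone (not_lt.1 hlt)
  rw [hi] at this
  exact Nat.find_spec hex ((h.le_one _).antisymm this)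

theorem eq_one_iff_lt_finrank_inf (h : IsPrincipalVectors V W s r σ x y) (i : ℕ) :
    σ i = 1 ↔ i < Module.finrank ℝ ↥(V ⊓ W) := by
  obtain ⟨N, hN⟩ := h.exists_eq_one_iff_lt
  have hNr : N ≤ r := by
    by_contra! hlt
    have := h.symm.eq_zero_of_le_left le_rfl
    rw [(hN r).2 hlt] at this
    exact one_ne_zero this
  rw [hN, h.inf_eq_span hN, finrank_span_eq_card (h.right.orthonormal hNr).linearIndependent,
    Fintype.card_fin]

theorem inner_eq_sum (h : IsPrincipalVectors V W s r σ x y) {z t : E} (hz : z ∈ V) (ht : t ∈ W) :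
    inner ℝ z t = ∑ i ∈ Finset.range s, σ i * (inner ℝ (x i) z * inner ℝ (y i) t) := by
  conv_lhs => rw [← h.sum_inner_smul_eq_left hz]
  rw [sum_inner]
  refine Finset.sum_congr rfl fun i _ => ?_
  rw [inner_smul_left, h.inner_left_of_mem ht, conj_trivial]
  ring

theorem cos_arccos (h : IsPrincipalVectors V W s r σ x y) (i : ℕ) :
    Real.cos (Real.arccos (σ i)) = σ i :=
  Real.cos_arccos (by linarith [h.nonneg i]) (h.le_one i)

/-- Principal vectors in the biorthogonal sense solve the recursive maximization problem. If the
components of `z` and `t` with index below `k` vanish, then `⟪z, t⟫` is a sum of products of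
components weighted by cosines at most `σ k`, hence at most `σ k` by Bessel's inequality. -/
theorem isPrincipalAngles (h : IsPrincipalVectors V W s r σ x y) {q : ℕ} (hqs : q ≤ s)
    (hqr : q ≤ r) : IsPrincipalAngles V W q fun i => Real.arccos (σ i) := by
  refine ⟨x, y, fun k hk => ⟨⟨Real.arccos_nonneg _, Real.arccos_le_pi_div_two.2 (h.nonneg k)⟩,
    ⟨h.left_mem k, h.left.norm_eq_one (hk.trans_le hqs), fun j hj => ?_⟩,
    ⟨h.right_mem k, h.right.norm_eq_one (hk.trans_le hqr), fun j hj => ?_⟩, ?_, ?_⟩⟩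
  · rw [h.left]; simp [hj.ne]
  · rw [h.right]; simp [hj.ne]
  · rw [h.inner_eq, if_pos rfl, h.cos_arccos]
  · intro z hz t ht hz1 ht1 hzx hty
    rw [h.cos_arccos, h.inner_eq_sum hz ht]
    have hbz := h.left.sum_sq_inner_le z s
    have hbt := h.right.sum_sq_inner_le t s
    rw [hz1] at hbz
    rw [ht1] at hbt
    have hle : ∀ i ∈ Finset.range s, σ i * (inner ℝ (x i) z * inner ℝ (y i) t) ≤
        σ k * ((inner ℝ (x i) z ^ 2 + inner ℝ (y i) t ^ 2) / 2) := by
      intro i _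
      by_cases hik : i < k
      · rw [hzx i hik, zero_mul, mul_zero]
        have := h.nonneg k
        positivity
      · have h1 := h.antitone (not_lt.1 hik)
        refine (mul_le_mul_of_nonneg_left (b := inner ℝ (x i) z * inner ℝ (y i) t) ?_
          (h.nonneg i)).trans (mul_le_mul_of_nonneg_right h1 (by positivity))
        linarith [two_mul_le_add_sq (inner ℝ (x i) z) (inner ℝ (y i) t)]
    refine (Finset.sum_le_sum hle).trans ?_
    rw [← Finset.mul_sum, ← Finset.sum_div, Finset.sum_add_distrib]
    exact mul_le_of_le_one_right (h.nonneg k) (by linarith)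

/-! ### The oblique projection attached to principal vectors -/

section Oblique

variable {D : E →L[ℝ] E}

theorem apply_eq_sum [FiniteDimensional ℝ E] (h : IsPrincipalVectors V W s r σ x y)
    (hx : ∀ i, D (x i) = (σ i)⁻¹ • y i) (hV : ∀ z ∈ Vᗮ, D z = 0) (z : E) :
    D z = ∑ i ∈ Finset.range s, (inner ℝ (x i) z * (σ i)⁻¹) • y i := by
  obtain ⟨a, ha, b, hb, rfl⟩ := V.exists_add_mem_mem_orthogonal z
  rw [map_add, hV b hb, add_zero]
  conv_lhs => rw [← h.sum_inner_smul_eq_left ha]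
  rw [map_sum]
  refine Finset.sum_congr rfl fun i _ => ?_
  rw [map_smul, hx, smul_smul, inner_add_right,
    Submodule.inner_right_of_mem_orthogonal (h.left_mem i) hb, add_zero]

theorem apply_right (h : IsPrincipalVectors V W s r σ x y)
    (hD : ∀ z, D z = ∑ i ∈ Finset.range s, (inner ℝ (x i) z * (σ i)⁻¹) • y i) {i : ℕ}
    (hi : i < s) : D (y i) = (σ i * (σ i)⁻¹) • y i := by
  rw [hD, Finset.sum_eq_single_of_mem i (Finset.mem_range.2 hi)]
  · rw [h.inner_eq, if_pos rfl]
  · intro j _ hj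
    rw [h.inner_eq, if_neg hj, zero_mul, zero_smul]

theorem isIdempotentElem (h : IsPrincipalVectors V W s r σ x y)
    (hD : ∀ z, D z = ∑ i ∈ Finset.range s, (inner ℝ (x i) z * (σ i)⁻¹) • y i) :
    IsIdempotentElem D := by
  ext1 z
  rw [mul_apply_eq_comp]
  conv_lhs => rw [hD z]
  rw [map_sum, hD z]
  refine Finset.sum_congr rfl fun i hi => ?_
  rw [map_smul, h.apply_right hD (Finset.mem_range.1 hi), smul_smul]
  congr 1
  by_cases h0 : σ i = 0
  · simp [h0]
  · field_simp

/-- The norm of the oblique projection is the inverse of the smallest nonzero cosine. -/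
theorem norm_eq (h : IsPrincipalVectors V W s r σ x y)
    (hx : ∀ i, D (x i) = (σ i)⁻¹ • y i)
    (hD : ∀ z, D z = ∑ i ∈ Finset.range s, (inner ℝ (x i) z * (σ i)⁻¹) • y i)
    {ρ : ℕ} (hρ : ∀ i, 0 < σ i ↔ i < ρ) (hpos : 0 < ρ) : ‖D‖ = (σ (ρ - 1))⁻¹ := by
  have hlast : 0 < σ (ρ - 1) := (hρ _).2 (by omega)
  have hinv : ∀ i, (σ i)⁻¹ ≤ (σ (ρ - 1))⁻¹ := by
    intro i
    by_cases hi : i < ρ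
    · exact inv_anti₀ hlast (h.antitone (by omega))
    · have : σ i = 0 := (not_lt.1 (mt (hρ i).1 hi)).antisymm (h.nonneg i)
      rw [this, inv_zero]
      exact (inv_pos.2 hlast).le
  apply le_antisymm
  · refine ContinuousLinearMap.opNorm_le_bound _ (inv_nonneg.2 hlast.le) fun z => ?_
    refine le_of_sq_le_sq ?_ (by positivity)
    rw [hD z]
    refine (h.right.norm_sq_sum_le _ s).trans ?_
    rw [mul_pow]
    refine le_trans ?_ (mul_le_mul_of_nonneg_left (h.left.sum_sq_inner_le z s) (by positivity))
    rw [Finset.mul_sum]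
    refine Finset.sum_le_sum fun i _ => ?_
    rw [mul_pow, mul_comm]
    exact mul_le_mul_of_nonneg_right
      (pow_le_pow_left₀ (inv_nonneg.2 (h.nonneg i)) (hinv i) 2) (sq_nonneg _)
  · have := D.le_opNorm (x (ρ - 1))
    rwa [hx, norm_smul, h.left.norm_eq_one (h.lt_left hlast),
      h.right.norm_eq_one (h.lt_right hlast), mul_one, mul_one, norm_inv,
      Real.norm_of_nonneg hlast.le] at this

end Oblique

/-! ### The canonical form -/

/-- The part of `y i` orthogonal to `x i`, normalized. -/
noncomputable def normalPart (σ : ℕ → ℝ) (x y : ℕ → E) (i : ℕ) : E :=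
  (Real.sin (Real.arccos (σ i)))⁻¹ • (y i - σ i • x i)

theorem inner_left_normalPart (h : IsPrincipalVectors V W s r σ x y) (i j : ℕ) :
    inner ℝ (x i) (normalPart σ x y j) = 0 := by
  rw [normalPart, inner_smul_right, inner_sub_right, inner_smul_right, h.inner_eq, h.left]
  by_cases hij : i = j
  · subst hij
    by_cases hi : i < s
    · simp [hi]
    · simp [h.eq_zero_of_le_left (not_lt.1 hi)]
  · simp [hij]

theorem sin_arccos_pos (h : IsPrincipalVectors V W s r σ x y) {i : ℕ} (hi : σ i ≠ 1) :
    0 < Real.sin (Real.arccos (σ i)) := by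
  rw [Real.sin_arccos]
  apply Real.sqrt_pos.2
  nlinarith [h.nonneg i, lt_of_le_of_ne (h.le_one i) hi]

theorem inner_normalPart (h : IsPrincipalVectors V W s r σ x y) {i : ℕ} (j : ℕ)
    (hi : 0 < σ i) (hi1 : σ i ≠ 1) :
    inner ℝ (normalPart σ x y i) (normalPart σ x y j) = if i = j then 1 else 0 := by
  have hs := (h.sin_arccos_pos hi1).ne'
  conv_lhs => rw [normalPart]
  rw [inner_smul_left, inner_sub_left, inner_smul_left, h.inner_left_normalPart, normalPart,
    inner_smul_right, inner_sub_right, inner_smul_right, h.right, h.symm.inner_eq]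
  by_cases hij : i = j
  · subst hij
    have h1 := Real.sin_sq_add_cos_sq (Real.arccos (σ i))
    rw [h.cos_arccos] at h1
    simp [h.lt_right hi]
    field_simp
    linarith
  · simp [hij]

theorem apply_left_eq_add (h : IsPrincipalVectors V W s r σ x y) {D : E →L[ℝ] E}
    (hx : ∀ i, D (x i) = (σ i)⁻¹ • y i) {i : ℕ} (hi : 0 < σ i) (hi1 : σ i ≠ 1) :
    D (x i) = x i + Real.tan (Real.arccos (σ i)) • normalPart σ x y i := by
  have hs := (h.sin_arccos_pos hi1).ne'
  rw [hx, normalPart, smul_smul, Real.tan_eq_sin_div_cos, h.cos_arccos,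
    show Real.sin (Real.arccos (σ i)) / σ i * (Real.sin (Real.arccos (σ i)))⁻¹ = (σ i)⁻¹ by
      field_simp, smul_sub, inv_smul_smul₀ hi.ne']
  abel

/-- The vectors in which the oblique projection takes its canonical form: the common vectors `x i`,
then the pairs `x i`, `normalPart i` for the angles strictly between `0` and `π / 2`. The last
summand of the index type is a placeholder for an orthonormal completion. -/
noncomputable def canonicalVectors (σ : ℕ → ℝ) (x y : ℕ → E) (ℓ p k : ℕ) :
    (Fin ℓ ⊕ Fin 2 × Fin p) ⊕ Fin k → E
  | .inl (.inl i) => x i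
  | .inl (.inr (0, i)) => x (ℓ + i)
  | .inl (.inr (1, i)) => normalPart σ x y (ℓ + i)
  | .inr _ => 0

theorem orthonormal_canonicalVectors (h : IsPrincipalVectors V W s r σ x y) {ℓ p : ℕ} (k : ℕ)
    (hℓ : ∀ i, σ i = 1 ↔ i < ℓ) (hp : ∀ i, 0 < σ i ↔ i < ℓ + p) :
    Orthonormal ℝ fun i => canonicalVectors σ x y ℓ p k (.inl i) := by
  have hs : ℓ + p ≤ s := by
    by_contra! hlt
    exact absurd (h.lt_left ((hp s).2 hlt)) (lt_irrefl _)
  have hpos : ∀ i : Fin p, 0 < σ (ℓ + i) := fun i => (hp _).2 (by omega)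
  have hne : ∀ i : Fin p, σ (ℓ + i) ≠ 1 := fun i => mt (hℓ _).1 (by omega)
  rw [orthonormal_iff_ite]
  rintro (i | ⟨a, i⟩) (j | ⟨b, j⟩)
  · have := i.2
    have := j.2
    simp only [canonicalVectors, h.left _ _, Sum.inl.injEq, Fin.ext_iff]
    congr 1
    simp only [eq_iff_iff, and_iff_left_iff_imp]
    omega
  · fin_cases b
    · have := i.2
      simp only [canonicalVectors, Fin.zero_eta, h.left _ _, reduceCtorEq, if_false]
      rw [if_neg (by omega)]
    · simp [canonicalVectors, h.inner_left_normalPart]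
  · fin_cases a
    · have := j.2
      simp only [canonicalVectors, Fin.zero_eta, h.left _ _, reduceCtorEq, if_false]
      rw [if_neg (by omega)]
    · simp [canonicalVectors, real_inner_comm, h.inner_left_normalPart]
  · have := i.2
    fin_cases a <;> fin_cases b
    · simp only [canonicalVectors, Fin.zero_eta, h.left _ _, Sum.inr.injEq, Prod.mk.injEq,
        true_and, Fin.ext_iff]
      congr 1
      simp only [eq_iff_iff]
      omega
    · simp [canonicalVectors, h.inner_left_normalPart]
    · simp [canonicalVectors, real_inner_comm, h.inner_left_normalPart]
    · simp [canonicalVectors, h.inner_normalPart _ (hpos i) (hne i), Fin.ext_iff]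

theorem add_two_mul_le_finrank [FiniteDimensional ℝ E] (h : IsPrincipalVectors V W s r σ x y)
    {ℓ p : ℕ} (hℓ : ∀ i, σ i = 1 ↔ i < ℓ) (hp : ∀ i, 0 < σ i ↔ i < ℓ + p) :
    ℓ + 2 * p ≤ Module.finrank ℝ E := by
  have := (h.orthonormal_canonicalVectors 0 hℓ hp).linearIndependent.fintype_card_le_finrank
  simpa using this

/-- The oblique projection has the canonical matrix in an orthonormal basis. -/
theorem exists_orthonormalBasis_apply_eq [FiniteDimensional ℝ E]
    (h : IsPrincipalVectors V W s r σ x y) {D : E →L[ℝ] E}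
    (hx : ∀ i, D (x i) = (σ i)⁻¹ • y i)
    (hD : ∀ z, D z = ∑ i ∈ Finset.range s, (inner ℝ (x i) z * (σ i)⁻¹) • y i)
    {ℓ p k : ℕ} (hℓ : ∀ i, σ i = 1 ↔ i < ℓ) (hp : ∀ i, 0 < σ i ↔ i < ℓ + p)
    (hk : ℓ + p * 2 + k = Module.finrank ℝ E) :
    ∃ b : OrthonormalBasis ((Fin ℓ ⊕ Fin 2 × Fin p) ⊕ Fin k) ℝ E,
      ∀ j, D (b j) = ∑ i, Matrix.fromBlocks (Matrix.fromBlocks (1 : Matrix (Fin ℓ) (Fin ℓ) ℝ) 0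
        0 (Matrix.blockDiagonal fun i : Fin p => blockT (Real.arccos (σ (ℓ + i))))) 0
        0 (0 : Matrix (Fin k) (Fin k) ℝ) i j • b i := by
  have hon : Orthonormal ℝ ((Set.range Sum.inl).domRestrict (canonicalVectors σ x y ℓ p k)) := by
    have h1 := h.orthonormal_canonicalVectors k hℓ hp
    rw [orthonormal_iff_ite] at h1 ⊢
    rintro ⟨_, i, rfl⟩ ⟨_, j, rfl⟩
    simpa [Subtype.ext_iff] using h1 i j
  obtain ⟨b, hb⟩ := hon.exists_orthonormalBasis_extension_of_card_eq (by
    rw [← hk]; simp; ring)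
  have hbl : ∀ i : Fin ℓ, b (.inl (.inl i)) = x i := fun i => hb _ ⟨_, rfl⟩
  have hb0 : ∀ i : Fin p, b (.inl (.inr (0, i))) = x (ℓ + i) := fun i => hb _ ⟨_, rfl⟩
  have hb1 : ∀ i : Fin p, b (.inl (.inr (1, i))) = normalPart σ x y (ℓ + i) :=
    fun i => hb _ ⟨_, rfl⟩
  have hbx : ∀ i, i < ℓ + p → ∃ j, b (.inl j) = x i := by
    intro i hi
    by_cases hil : i < ℓ
    · exact ⟨.inl ⟨i, hil⟩, hbl _⟩
    · refine ⟨.inr (0, ⟨i - ℓ, by omega⟩), ?_⟩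
      rw [hb0]
      congr 1
      simp only
      omega
  refine ⟨b, ?_⟩
  rintro ((j | ⟨a, j⟩) | j)
  · have hj := (hℓ j).2 j.2
    have hD1 : D (b (.inl (.inl j))) = b (.inl (.inl j)) := by
      rw [hbl, hx, hj, inv_one, one_smul, h.eq_of_eq_one hj]
    rw [hD1]
    simp [Fintype.sum_sum_type, Matrix.one_apply]
  · fin_cases a
    · simp only [Fin.zero_eta, Fintype.sum_sum_type, Matrix.fromBlocks_apply₁₁,
        Matrix.fromBlocks_apply₁₂, Matrix.fromBlocks_apply₂₁, Matrix.fromBlocks_apply₂₂,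
        Matrix.zero_apply, zero_smul, Finset.sum_const_zero, zero_add, add_zero,
        Fintype.sum_prod_type, Fin.sum_univ_two, Matrix.blockDiagonal_apply, ite_smul,
        Finset.sum_ite_eq', Finset.mem_univ, if_true, hb0, hb1]
      rw [h.apply_left_eq_add hx ((hp _).2 (by omega)) (mt (hℓ _).1 (by omega))]
      simp [blockT]
    · have hz : D (b (.inl (.inr (1, j)))) = 0 := by
        rw [hb1, hD]
        simp [h.inner_left_normalPart]
      simp only [Fin.mk_one, hz, Fintype.sum_sum_type, Matrix.fromBlocks_apply₁₁,
        Matrix.fromBlocks_apply₁₂, Matrix.fromBlocks_apply₂₁, Matrix.fromBlocks_apply₂₂,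
        Matrix.zero_apply, zero_smul, Finset.sum_const_zero, zero_add, add_zero,
        Fintype.sum_prod_type, Fin.sum_univ_two, Matrix.blockDiagonal_apply, ite_smul,
        Finset.sum_ite_eq', Finset.mem_univ, if_true]
      simp [blockT]
  · have hz : D (b (.inr j)) = 0 := by
      rw [hD]
      refine Finset.sum_eq_zero fun i _ => ?_
      by_cases hi : i < ℓ + p
      · obtain ⟨j', hj'⟩ := hbx i hi
        rw [← hj', b.inner_eq_ite, if_neg (by simp), zero_mul, zero_smul]
      · have : σ i = 0 := (not_lt.1 (mt (hp i).1 hi)).antisymm (h.nonneg i)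
        simp [this]
    simp [hz, Fintype.sum_sum_type]

end IsPrincipalVectors

/-! ### Moore-Penrose inverses -/

/-- A Moore-Penrose inverse inverts the singular value relations. For `σ = 0` this says that it
annihilates the kernel of `Aᵀ`. -/
theorem IsMoorePenrose.mulVec_eq {a b : Type*} [Fintype a] [Fintype b]
    {A : Matrix a b ℝ} {X : Matrix b a ℝ} (h : IsMoorePenrose A X) {σ : ℝ} {x : a → ℝ} {y : b → ℝ}
    (hy : A *ᵥ y = σ • x) (hx : Aᵀ *ᵥ x = σ • y) : X *ᵥ x = σ⁻¹ • y := by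
  by_cases h0 : σ = 0
  · subst h0
    have hX : X = X * Xᵀ * Aᵀ := by
      rw [Matrix.mul_assoc, ← Matrix.transpose_mul, h.left_symm, ← Matrix.mul_assoc,
        h.self_mul_mul]
    rw [hX, ← Matrix.mulVec_mulVec, hx]
    simp
  · have hA : X * A * Aᵀ = Aᵀ := by
      rw [← h.right_symm, ← Matrix.transpose_mul, ← Matrix.mul_assoc, h.mul_mul_self]
    have hyy : (X * A) *ᵥ y = y := by
      have hy' : y = σ⁻¹ • (Aᵀ *ᵥ x) := by rw [hx, inv_smul_smul₀ h0]
      conv_lhs => rw [hy']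
      rw [Matrix.mulVec_smul, Matrix.mulVec_mulVec, hA, ← hy']
    have hx' : x = σ⁻¹ • (A *ᵥ y) := by rw [hy, inv_smul_smul₀ h0]
    rw [hx', Matrix.mulVec_smul, Matrix.mulVec_mulVec, hyy]

theorem IsMoorePenrose.rank_eq {a b : Type*} [Fintype a] [Fintype b]
    {A : Matrix a b ℝ} {X : Matrix b a ℝ} (h : IsMoorePenrose A X) : X.rank = A.rank := by
  apply le_antisymm
  · conv_lhs => rw [← h.self_mul_mul]
    exact (Matrix.rank_mul_le_left _ _).trans (Matrix.rank_mul_le_right _ _)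
  · conv_lhs => rw [← h.mul_mul_self]
    exact (Matrix.rank_mul_le_left _ _).trans (Matrix.rank_mul_le_right _ _)

section Isometry

variable {m r s : ℕ} {U : Matrix (Fin m) (Fin r) ℝ} {S : Matrix (Fin m) (Fin s) ℝ}

/-- Moore-Penrose inverses are compatible with multiplication by matrices with orthonormal
columns. -/
theorem IsMoorePenrose.mul_mul_transpose (hU : Uᵀ * U = 1) (hS : Sᵀ * S = 1)
    {A : Matrix (Fin s) (Fin r) ℝ} {X : Matrix (Fin r) (Fin s) ℝ} (h : IsMoorePenrose A X) :
    IsMoorePenrose (S * A * Uᵀ) (U * X * Sᵀ) := by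
  have e1 : S * A * Uᵀ * (U * X * Sᵀ) = S * (A * X) * Sᵀ := by
    calc _ = S * A * (Uᵀ * U) * X * Sᵀ := by simp only [Matrix.mul_assoc]
      _ = _ := by rw [hU]; simp only [Matrix.mul_assoc, Matrix.mul_one]
  have e2 : U * X * Sᵀ * (S * A * Uᵀ) = U * (X * A) * Uᵀ := by
    calc _ = U * X * (Sᵀ * S) * A * Uᵀ := by simp only [Matrix.mul_assoc]
      _ = _ := by rw [hS]; simp only [Matrix.mul_assoc, Matrix.mul_one]
  refine ⟨?_, ?_, ?_, ?_⟩
  · calc _ = S * (A * X) * (Sᵀ * S) * A * Uᵀ := by rw [e1]; simp only [Matrix.mul_assoc]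
      _ = S * (A * X * A) * Uᵀ := by
        rw [hS]; simp only [Matrix.mul_assoc, Matrix.one_mul]
      _ = _ := by rw [h.mul_mul_self]
  · calc _ = U * (X * A) * (Uᵀ * U) * X * Sᵀ := by rw [e2]; simp only [Matrix.mul_assoc]
      _ = U * (X * A * X) * Sᵀ := by
        rw [hU]; simp only [Matrix.mul_assoc, Matrix.one_mul]
      _ = _ := by rw [h.self_mul_mul]
  · rw [e1, Matrix.transpose_mul, Matrix.transpose_mul, h.left_symm, Matrix.transpose_transpose]
    simp only [Matrix.mul_assoc]
  · rw [e2, Matrix.transpose_mul, Matrix.transpose_mul, h.right_symm, Matrix.transpose_transpose]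
    simp only [Matrix.mul_assoc]

theorem rank_mul_mul_transpose (hU : Uᵀ * U = 1) (hS : Sᵀ * S = 1)
    (X : Matrix (Fin r) (Fin s) ℝ) : (U * X * Sᵀ).rank = X.rank := by
  apply le_antisymm
  · exact (Matrix.rank_mul_le_left _ _).trans (Matrix.rank_mul_le_right _ _)
  · have : X = Uᵀ * (U * X * Sᵀ) * S := by
      calc X = (Uᵀ * U) * X * (Sᵀ * S) := by rw [hU, hS, Matrix.one_mul, Matrix.mul_one]
        _ = _ := by simp only [Matrix.mul_assoc]
    conv_lhs => rw [this]
    exact (Matrix.rank_mul_le_left _ _).trans (Matrix.rank_mul_le_right _ _)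

/-! ### Principal vectors of column spaces -/

theorem inner_toEuclideanLin_left {a b : ℕ} (A : Matrix (Fin a) (Fin b) ℝ)
    (z : EuclideanSpace ℝ (Fin b)) (w : EuclideanSpace ℝ (Fin a)) :
    inner ℝ (Matrix.toEuclideanLin A z) w = inner ℝ z (Matrix.toEuclideanLin Aᵀ w) := by
  rw [← Matrix.conjTranspose_eq_transpose_of_trivial, Matrix.toEuclideanLin_conjTranspose_eq_adjoint,
    LinearMap.adjoint_inner_right]

theorem toEuclideanLin_toEuclideanLin {a b c : ℕ} (A : Matrix (Fin a) (Fin b) ℝ)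
    (B : Matrix (Fin b) (Fin c) ℝ) (z : EuclideanSpace ℝ (Fin c)) :
    Matrix.toEuclideanLin A (Matrix.toEuclideanLin B z) = Matrix.toEuclideanLin (A * B) z := by
  simp [Matrix.toLpLin_apply, Matrix.mulVec_mulVec]

theorem inner_toEuclideanLin {a b c : ℕ} (A : Matrix (Fin a) (Fin b) ℝ)
    (B : Matrix (Fin a) (Fin c) ℝ) (z : EuclideanSpace ℝ (Fin b)) (w : EuclideanSpace ℝ (Fin c)) :
    inner ℝ (Matrix.toEuclideanLin A z) (Matrix.toEuclideanLin B w) =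
      inner ℝ z (Matrix.toEuclideanLin (Aᵀ * B) w) := by
  rw [inner_toEuclideanLin_left, toEuclideanLin_toEuclideanLin]

theorem toEuclideanLin_one_apply {a : ℕ} (z : EuclideanSpace ℝ (Fin a)) :
    Matrix.toEuclideanLin (1 : Matrix (Fin a) (Fin a) ℝ) z = z := by
  simp

theorem finrank_range_toEuclideanLin {a b : ℕ} (A : Matrix (Fin a) (Fin b) ℝ) :
    Module.finrank ℝ (LinearMap.range (Matrix.toEuclideanLin A)) = A.rank := by
  rw [Matrix.rank_eq_finrank_range_toLin A (EuclideanSpace.basisFun (Fin a) ℝ).toBasis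
    (EuclideanSpace.basisFun (Fin b) ℝ).toBasis, Matrix.toEuclideanLin_eq_toLin_orthonormal]

/-- The images of singular vectors of `Sᵀ * U` are principal vectors of the column spaces, and
`U * (Sᵀ * U)⁺ * Sᵀ` acts on them as the Moore-Penrose inverse of `Sᵀ * U` on singular vectors. -/
theorem exists_isPrincipalVectors_colSpace (hU : Uᵀ * U = 1) (hS : Sᵀ * S = 1) :
    ∃ x y : ℕ → EuclideanSpace ℝ (Fin m),
      IsPrincipalVectors (colSpace S) (colSpace U) s r (matrixSingularValue (Sᵀ * U)) x y ∧
      ∀ i, Matrix.toEuclideanLin (U * pinv (Sᵀ * U) * Sᵀ) (x i) =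
        (matrixSingularValue (Sᵀ * U) i)⁻¹ • y i := by
  obtain ⟨u, v, hu, hv, hus, hvs, hTu, hTv⟩ :=
    (Matrix.toEuclideanLin (Sᵀ * U)).exists_singularVectors (r := r) (s := s) (by simp) (by simp)
  rw [← Matrix.toEuclideanLin_conjTranspose_eq_adjoint,
    Matrix.conjTranspose_eq_transpose_of_trivial] at hTv
  refine ⟨fun i => Matrix.toEuclideanLin S (v i), fun i => Matrix.toEuclideanLin U (u i),
    ⟨?_, ?_, ?_, ?_, ?_, ?_, ?_⟩, ?_⟩
  · intro i j
    rw [inner_toEuclideanLin, hS, toEuclideanLin_one_apply, hv]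
  · intro i j
    rw [inner_toEuclideanLin, hU, toEuclideanLin_one_apply, hu]
  · rw [colSpace, LinearMap.range_eq_map, ← hvs, Submodule.map_span, ← Set.range_comp]
    rfl
  · rw [colSpace, LinearMap.range_eq_map, ← hus, Submodule.map_span, ← Set.range_comp]
    rfl
  · intro i j
    rw [inner_toEuclideanLin, hTu, inner_smul_right, hv]
    by_cases hij : i = j
    · subst hij
      by_cases hi : i < s
      · simp [hi, matrixSingularValue]
      · have h0 : matrixSingularValue (Sᵀ * U) i = 0 :=
          (Matrix.toEuclideanLin (Sᵀ * U)).singularValues_eq_zero_iff_le_finrank_range.2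
            ((Submodule.finrank_le _).trans (by simpa using hi))
        rw [if_pos rfl, h0, if_neg (fun h => hi h.2), mul_zero]
    · simp [hij]
  · exact (Matrix.toEuclideanLin (Sᵀ * U)).singularValues_antitone
  · exact (Matrix.toEuclideanLin (Sᵀ * U)).singularValues_nonneg
  · intro i
    have hX : pinv (Sᵀ * U) *ᵥ (v i).ofLp = (matrixSingularValue (Sᵀ * U) i)⁻¹ • (u i).ofLp :=
      (pinv_spec (Sᵀ * U)).mulVec_eq (congrArg WithLp.ofLp (hTu i)) (congrArg WithLp.ofLp (hTv i))
    rw [toEuclideanLin_toEuclideanLin, Matrix.mul_assoc, hS, Matrix.mul_one, ← map_smul,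
      ← toEuclideanLin_toEuclideanLin]
    congr 1
    rw [Matrix.toLpLin_apply, hX]
    rfl

theorem toEuclideanLin_transpose_eq_zero_of_mem_orthogonal {z : EuclideanSpace ℝ (Fin m)}
    (hz : z ∈ (colSpace S)ᗮ) : Matrix.toEuclideanLin Sᵀ z = 0 := by
  rw [← inner_self_eq_zero (𝕜 := ℝ), ← inner_toEuclideanLin_left]
  exact Submodule.inner_right_of_mem_orthogonal (LinearMap.mem_range_self _ _) hz

end Isometry

/-! ### Matrices in an orthonormal basis -/

theorem exists_mem_orthogonalGroup_eq_mul_reindex_mul {m : ℕ} {ι : Type*} [Fintype ι]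
    {D : Matrix (Fin m) (Fin m) ℝ} {M : Matrix ι ι ℝ}
    (b : OrthonormalBasis ι ℝ (EuclideanSpace ℝ (Fin m)))
    (h : ∀ j, Matrix.toEuclideanLin D (b j) = ∑ i, M i j • b i) (e : ι ≃ Fin m) :
    ∃ Z ∈ Matrix.orthogonalGroup (Fin m) ℝ, D = Z * Matrix.reindex e e M * Zᵀ := by
  set Z : Matrix (Fin m) (Fin m) ℝ :=
    (EuclideanSpace.basisFun (Fin m) ℝ).toBasis.toMatrix (b.reindex e) with hZ
  have hmem : Z ∈ Matrix.orthogonalGroup (Fin m) ℝ :=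
    (EuclideanSpace.basisFun (Fin m) ℝ).toMatrix_orthonormalBasis_mem_unitary (b.reindex e)
  have happ : ∀ a c, Z a c = b (e.symm c) a := by
    intro a c
    simp [hZ, Module.Basis.toMatrix_apply]
  have hZZ : Z * Zᵀ = 1 := (Matrix.mem_orthogonalGroup_iff (Fin m) ℝ).1 hmem
  have hDZ : D * Z = Z * Matrix.reindex e e M := by
    ext a c
    have h1 := congrArg (fun w : EuclideanSpace ℝ (Fin m) => w a) (h (e.symm c))
    simp only [Matrix.toLpLin_apply, WithLp.ofLp_sum, WithLp.ofLp_smul, Finset.sum_apply,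
      Pi.smul_apply, smul_eq_mul, Matrix.mulVec, dotProduct] at h1
    simp only [Matrix.mul_apply, happ, h1, Matrix.reindex_apply, Matrix.submatrix_apply]
    rw [← Equiv.sum_comp e]
    simp [mul_comm]
  refine ⟨Z, hmem, ?_⟩
  rw [← hDZ, Matrix.mul_assoc, hZZ, Matrix.mul_one]

/-- `canonicalForm` as a reindexed block matrix. -/
theorem exists_equiv_reindex_canonicalForm {ℓ p k m : ℕ} (h : ℓ + p * 2 + k = m)
    (ψ : Fin p → ℝ) :
    ∃ e : (Fin ℓ ⊕ Fin 2 × Fin p) ⊕ Fin k ≃ Fin m,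
      Matrix.reindex (finCongr h) (finCongr h) (canonicalForm ℓ p k ψ) =
        Matrix.reindex e e (Matrix.fromBlocks (Matrix.fromBlocks (1 : Matrix (Fin ℓ) (Fin ℓ) ℝ) 0
          0 (Matrix.blockDiagonal fun i => blockT (ψ i))) 0 0 (0 : Matrix (Fin k) (Fin k) ℝ)) := by
  refine ⟨(((Equiv.sumCongr (((Equiv.sumCongr (Equiv.refl _)
    ((Equiv.prodComm _ _).trans finProdFinEquiv)).trans finSumFinEquiv)) (Equiv.refl _)).trans
      finSumFinEquiv).trans (finCongr h)), ?_⟩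
  subst h
  ext i j
  obtain ⟨i, rfl⟩ := finSumFinEquiv.surjective i
  obtain ⟨j, rfl⟩ := finSumFinEquiv.surjective j
  rcases i with i | i <;> rcases j with j | j
  · obtain ⟨i, rfl⟩ := finSumFinEquiv.surjective i
    obtain ⟨j, rfl⟩ := finSumFinEquiv.surjective j
    rcases i with i | i <;> rcases j with j | j <;> simp [canonicalForm]
  all_goals simp [canonicalForm]

/-! ### Singular values, angles, canonical form and norm -/

theorem theorem3p1 (m r s : ℕ) (hr : 1 ≤ r) (hrm : r ≤ m) (hs : 1 ≤ s) (hsm : s ≤ m)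
    (U : Matrix (Fin m) (Fin r) ℝ) (S : Matrix (Fin m) (Fin s) ℝ)
    (hU : Uᵀ * U = 1) (hS : Sᵀ * S = 1)
    (D : Matrix (Fin m) (Fin m) ℝ) (hD : D = U * pinv (Sᵀ * U) * Sᵀ)
    (ℓ p : ℕ) (hℓ : ℓ = Module.finrank ℝ ↥(colSpace S ⊓ colSpace U)) (hp : p = D.rank - ℓ)
    -- indices start at `0`: `σ i` and `ψ i` are the `(i + 1)`-st singular value and angle
    (σ ψ : ℕ → ℝ) (hσ : ∀ i, σ i = matrixSingularValue (Sᵀ * U) i)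
    (hψ : ∀ i, ψ i = Real.arccos (σ i)) :
    -- the ordering of the singular values and the principal angles
    (ℓ ≤ D.rank ∧ ℓ + p ≤ min r s ∧
      (∀ i, σ i = Real.cos (ψ i)) ∧
      Antitone σ ∧
      (∀ i < ℓ, σ i = 1) ∧
      (∀ i, ℓ ≤ i → i < ℓ + p → 0 < σ i ∧ σ i < 1) ∧
      (∀ i, ℓ + p ≤ i → i < min r s → σ i = 0) ∧
      Monotone ψ ∧
      (∀ i, ℓ ≤ i → i < ℓ + p → 0 < ψ i ∧ ψ i < Real.pi / 2) ∧
      IsPrincipalAngles (colSpace S) (colSpace U) (min r s) ψ) ∧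
    -- (i) the canonical form
    (D = pinv ((S * Sᵀ) * (U * Uᵀ)) ∧
      ∃ h : ℓ + p * 2 + (m - ℓ - 2 * p) = m,
        ∃ Z ∈ Matrix.orthogonalGroup (Fin m) ℝ,
          D = Z * Matrix.reindex (finCongr h) (finCongr h)
            (canonicalForm ℓ p (m - ℓ - 2 * p) fun i => ψ (ℓ + i)) * Zᵀ) ∧
    -- (ii) the spectral norms
    (D ≠ 0 → 0 < ℓ + p ∧ ‖D‖ = 1 / Real.cos (ψ (ℓ + p - 1))) ∧
    (D ≠ 0 → D ≠ 1 →
      ‖D‖ = ‖1 - D‖ ∧ ‖1 - D‖ = 1 / Real.cos (ψ (ℓ + p - 1))) := by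

  have hσ' : σ = matrixSingularValue (Sᵀ * U) := funext hσ
  have hψ' : ψ = fun i => Real.arccos (σ i) := funext hψ
  obtain ⟨x, y, h, hx⟩ := exists_isPrincipalVectors_colSpace hU hS
  rw [← hσ'] at h hx
  rw [← hD] at hx
  have hone : ∀ i, σ i = 1 ↔ i < ℓ := fun i => hℓ ▸ h.eq_one_iff_lt_finrank_inf i
  have hrank : D.rank = (Sᵀ * U).rank := by
    rw [hD, rank_mul_mul_transpose hU hS, (pinv_spec _).rank_eq]
  have hpos' : ∀ i, 0 < σ i ↔ i < D.rank := by
    intro i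
    rw [hσ, hrank, ← finrank_range_toEuclideanLin]
    exact LinearMap.singularValues_pos_iff_lt_finrank_range _
  have hℓD : ℓ ≤ D.rank := by
    by_contra! hlt
    have h1 := (hpos' D.rank).1 ((hone _).2 hlt ▸ zero_lt_one)
    exact lt_irrefl _ h1
  have hsum : ℓ + p = D.rank := by omega
  have hpos : ∀ i, 0 < σ i ↔ i < ℓ + p := hsum ▸ hpos'
  have hcos : ∀ i, σ i = Real.cos (ψ i) := fun i => by rw [hψ, h.cos_arccos]
  have hzero : ∀ i, ℓ + p ≤ i → σ i = 0 := fun i hi =>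
    (not_lt.1 (mt (hpos i).1 (not_lt.2 hi))).antisymm (h.nonneg i)
  have hlt1 : ∀ i, ℓ ≤ i → σ i < 1 := fun i hi =>
    lt_of_le_of_ne (h.le_one i) (mt (hone i).1 (not_lt.2 hi))
  have hmin : ℓ + p ≤ min r s := by
    rw [hsum, hrank]
    refine le_min ?_ ?_
    · simpa using (Sᵀ * U).rank_le_width
    · simpa using (Sᵀ * U).rank_le_height
  set T := Matrix.toEuclideanCLM (n := Fin m) (𝕜 := ℝ) D with hT
  have hT0 : T = 0 ↔ D = 0 := EmbeddingLike.map_eq_zero_iff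
  have hT1 : T = 1 ↔ D = 1 := EmbeddingLike.map_eq_one_iff
  have hTx : ∀ i, T (x i) = (σ i)⁻¹ • y i := hx
  have hTV : ∀ z ∈ (colSpace S)ᗮ, T z = 0 := by
    intro z hz
    change Matrix.toEuclideanLin D z = 0
    rw [hD, ← toEuclideanLin_toEuclideanLin,
      toEuclideanLin_transpose_eq_zero_of_mem_orthogonal hz, map_zero]
  have hTz := h.apply_eq_sum hTx hTV
  have hnorm : 0 < ℓ + p → ‖D‖ = 1 / Real.cos (ψ (ℓ + p - 1)) := by
    intro h0
    rw [Matrix.cstar_norm_def, ← hT, h.norm_eq hTx hTz hpos h0, hcos, one_div]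
  have hne : D ≠ 0 → 0 < ℓ + p := by
    intro hD0
    by_contra h0
    refine hD0 (hT0.1 (ContinuousLinearMap.ext fun z => ?_))
    rw [hTz]
    exact Finset.sum_eq_zero fun i _ => by simp [hzero i (by omega)]
  refine ⟨⟨hℓD, hmin, hcos, h.antitone, fun i hi => (hone i).2 hi,
    fun i hi hi' => ⟨(hpos i).2 hi', hlt1 i hi⟩, fun i hi _ => hzero i hi, ?_, ?_, ?_⟩, ⟨?_, ?_⟩,
    fun hD0 => ⟨hne hD0, hnorm (hne hD0)⟩, fun hD0 hD1 => ?_⟩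
  · intro i j hij
    rw [hψ, hψ]
    exact Real.arccos_le_arccos (h.antitone hij)
  · intro i hi hi'
    rw [hψ]
    exact ⟨Real.arccos_pos.2 (hlt1 i hi), Real.arccos_lt_pi_div_two.2 ((hpos i).2 hi')⟩
  · rw [hψ']
    exact h.isPrincipalAngles (min_le_right _ _) (min_le_left _ _)
  · rw [show S * Sᵀ * (U * Uᵀ) = S * (Sᵀ * U) * Uᵀ by simp only [Matrix.mul_assoc], hD]
    exact ((pinv_spec (Sᵀ * U)).mul_mul_transpose hU hS).unique (pinv_spec _)
  · have hdim := h.add_two_mul_le_finrank hone hpos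
    rw [finrank_euclideanSpace_fin] at hdim
    have hk : ℓ + p * 2 + (m - ℓ - 2 * p) = m := by omega
    refine ⟨hk, ?_⟩
    obtain ⟨b, hb⟩ := h.exists_orthonormalBasis_apply_eq hTx hTz hone hpos
      (hk.trans finrank_euclideanSpace_fin.symm)
    obtain ⟨e, he⟩ := exists_equiv_reindex_canonicalForm hk fun i => ψ (ℓ + i)
    rw [he, hψ']
    exact exists_mem_orthogonalGroup_eq_mul_reindex_mul b hb e
  · have h1 : ‖1 - T‖ = ‖T‖ :=
      norm_one_sub_eq_of_isIdempotentElem (h.isIdempotentElem hTz) (mt hT0.1 hD0) (mt hT1.1 hD1)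
    have h2 : ‖1 - D‖ = ‖D‖ := by
      rw [Matrix.cstar_norm_def, Matrix.cstar_norm_def, map_sub, map_one]
      exact h1
    exact ⟨h2.symm, h2.trans (hnorm (hne hD0))⟩
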